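/- Let $R=(r_1,\dots,r_m)$ be a composition of $n$ (positive integers with $\sum_i r_i=n$). Conjugate partition: for $i\ge 1$ put $T_i=\{j : r_j\ge i\}$. Let $S_i$ be the multiset of lengths of the maximal runs of consecutive integers in $T_i$. The conjugate partition $R^t$ is the partition of $n$ whose parts are those of all the $S_i$, $i\ge 1$, taken with multiplicity. For a partition $\lambda$ of $n$ put $$C_\lambda=\frac{4}{\sum_{p}\sum_{s=1}^{\lambda_p}(\lambda_p+1-2s)^2}.$$ For a nonzero matrix $A\in M_n(\mathbb C)$ put $K(A)=\|[A,A^*]\|^2/\|A\|^4$, where $A^*$ is the conjugate transpose and $\|X\|^2=\operatorname{tr}(XX^*)$. Let $A\in M_n(\mathbb C)$ be of type $R$ with respect to a (not necessarily orthogonal) direct sum decomposition $\mathbb C^n=V_1\oplus\dots\oplus V_m$. That is, $\dim V_i=r_i$, $A(V_i)\subset V_{i+1}$ for $i<m$, and $A(V_m)=0$. (a) If $A\neq 0$, then $K(A)\ge C_{R^t}$. (b) Suppose $m\ge 2$ and the $V_i$ are pairwise orthogonal for the standard Hermitian inner product. Suppose that each $V_i$ is the orthogonal sum of $r_i$ lines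 $L_i^1,\dots,L_i^{r_i}$ such that $A$ maps $L_i^s$ isomorphically onto $L_{i+1}^s$ if $i<m$ and $s\le r_{i+1}$, and is zero on $L_i^s$ otherwise. For each $i$ and $s\le r_i$ let $[j_0,j_1]\ni i$ be the maximal interval of positions such that $A|_{L_j^s}$ is nonzero for all $j_0\le j<j_1$. Suppose there are unit vectors $v_i^s\in L_i^s$ with $$A v_i^s=\sqrt{(i-j_0+1)(j_1-i)}\;v_{i+1}^s\qquad\text{whenever } i<m,\ s\le r_{i+1}.$$ Then $A\ne 0$ and $K(A)=C_{R^t}$. -/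

import Mathlib

/-- The runs of a finite set `T` of natural numbers: the pairs `(a, b)` with `a ≤ b` such that
`{a, …, b}` is a maximal set of consecutive integers inside `T`. -/
def runs (T : Finset ℕ) : Finset (ℕ × ℕ) :=
  (T ×ˢ T).filter fun p =>
    p.1 ≤ p.2 ∧ Finset.Icc p.1 p.2 ⊆ T ∧ (∀ c ∈ T, c + 1 ≠ p.1) ∧ p.2 + 1 ∉ T

/-- The multiset of lengths of the runs of `T`. -/
def runLengths (T : Finset ℕ) : Multiset ℕ :=
  (runs T).val.map fun p => p.2 + 1 - p.1

theorem mem_runs {T : Finset ℕ} {a b : ℕ} :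
    (a, b) ∈ runs T ↔
      a ≤ b ∧ Finset.Icc a b ⊆ T ∧ (∀ c ∈ T, c + 1 ≠ a) ∧ b + 1 ∉ T := by
  simp only [runs, Finset.mem_filter, Finset.mem_product]
  constructor
  · exact fun h => h.2
  · exact fun h => ⟨⟨h.2.1 (Finset.mem_Icc.2 ⟨le_rfl, h.1⟩),
      h.2.1 (Finset.mem_Icc.2 ⟨h.1, le_rfl⟩)⟩, h⟩

theorem exists_run {T : Finset ℕ} {j : ℕ} (hj : j ∈ T) :
    ∃ p ∈ runs T, j ∈ Finset.Icc p.1 p.2 := by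
  classical
  have h1 : ∃ a, a ≤ j ∧ Finset.Icc a j ⊆ T := ⟨j, le_rfl, by simpa using hj⟩
  have h2 : ∃ b, j ≤ b ∧ b + 1 ∉ T := by
    obtain ⟨N, hN⟩ := T.bddAbove
    exact ⟨max j N, le_max_left _ _, fun h => by
      have := hN h
      have := le_max_right j N
      omega⟩
  refine ⟨(Nat.find h1, Nat.find h2), mem_runs.2 ?_, ?_⟩
  · obtain ⟨ha, haT⟩ := Nat.find_spec h1
    obtain ⟨hb, hbT⟩ := Nat.find_spec h2
    refine ⟨ha.trans hb, ?_, ?_, hbT⟩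
    · intro x hx
      rw [Finset.mem_Icc] at hx
      by_cases hxj : x ≤ j
      · exact haT (Finset.mem_Icc.2 ⟨hx.1, hxj⟩)
      · by_contra hxT
        refine Nat.find_min h2 (m := x - 1) (by omega) ⟨by omega, ?_⟩
        rwa [show x - 1 + 1 = x by omega]
    · intro c hc hca
      refine Nat.find_min h1 (m := c) (by omega) ⟨by omega, ?_⟩
      intro x hx
      rw [Finset.mem_Icc] at hx
      by_cases hxc : x = c
      · rwa [hxc]
      · exact haT (Finset.mem_Icc.2 ⟨by omega, hx.2⟩)
  · exact Finset.mem_Icc.2 ⟨(Nat.find_spec h1).1, (Nat.find_spec h2).1⟩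

theorem run_unique {T : Finset ℕ} {p q : ℕ × ℕ} (hp : p ∈ runs T) (hq : q ∈ runs T) {j : ℕ}
    (hjp : j ∈ Finset.Icc p.1 p.2) (hjq : j ∈ Finset.Icc q.1 q.2) : p = q := by
  obtain ⟨a, b⟩ := p
  obtain ⟨c, d⟩ := q
  obtain ⟨-, h1, h2, h3⟩ := mem_runs.1 hp
  obtain ⟨-, k1, k2, k3⟩ := mem_runs.1 hq
  simp only [Finset.mem_Icc] at hjp hjq
  have hac : ¬ a < c := fun h =>
    k2 (c - 1) (h1 (Finset.mem_Icc.2 ⟨by omega, by omega⟩)) (by omega)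
  have hca : ¬ c < a := fun h =>
    h2 (a - 1) (k1 (Finset.mem_Icc.2 ⟨by omega, by omega⟩)) (by omega)
  have hbd : ¬ b < d := fun h => h3 (k1 (Finset.mem_Icc.2 ⟨by omega, by omega⟩))
  have hdb : ¬ d < b := fun h => k3 (h1 (Finset.mem_Icc.2 ⟨by omega, by omega⟩))
  ext <;> simp <;> omega

theorem sum_runLengths (T : Finset ℕ) : (runLengths T).sum = T.card := by
  classical
  have hT : T = (runs T).biUnion fun p => Finset.Icc p.1 p.2 := by
    ext j
    simp only [Finset.mem_biUnion]
    constructor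
    · exact exists_run
    · rintro ⟨p, hp, hj⟩
      exact (mem_runs.1 hp).2.1 hj
  have hcard : ((runs T).biUnion fun p => Finset.Icc p.1 p.2).card
      = ∑ p ∈ runs T, (p.2 + 1 - p.1) := by
    rw [Finset.card_biUnion]
    · simp
    · intro p hp q hq hpq
      exact Finset.disjoint_left.2 fun j hj hj' => hpq (run_unique hp hq hj hj')
  rw [← hT] at hcard
  exact hcard.symm

/-- The set `T_i` of positions `j` (counted from `0`) of the composition `R = (r_j)` with
`r_j ≥ i`. -/
def levelSet {n : ℕ} (R : Composition n) (i : ℕ) : Finset ℕ :=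
  (Finset.univ.filter fun j : Fin R.length => i ≤ R.blocksFun j).map Fin.valEmbedding

theorem sum_card_levelSet {n : ℕ} (R : Composition n) :
    ∑ i ∈ Finset.Icc 1 n, (levelSet R i).card = n := by
  have h : ∀ j : Fin R.length,
      (∑ i ∈ Finset.Icc 1 n, if i ≤ R.blocksFun j then 1 else 0) = R.blocksFun j := by
    intro j
    have hj : R.blocksFun j ≤ n := by
      conv_rhs => rw [← R.sum_blocksFun]
      exact Finset.single_le_sum (f := R.blocksFun) (fun _ _ => Nat.zero_le _)
        (Finset.mem_univ j)
    rw [← Finset.card_filter]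
    have : (Finset.Icc 1 n).filter (fun i => i ≤ R.blocksFun j)
        = Finset.Icc 1 (R.blocksFun j) := by
      ext i
      simp only [Finset.mem_filter, Finset.mem_Icc]
      omega
    rw [this]
    simp
  simp only [levelSet, Finset.card_map, Finset.card_filter]
  rw [Finset.sum_comm]
  simp only [h, R.sum_blocksFun]

/-- The conjugate partition `Rᵗ` of a composition `R` of `n`: the disjoint union, over
`i = 1, …, n`, of the lengths of the maximal runs of consecutive positions `j` with `r_j ≥ i`. -/
def conjugatePartition {n : ℕ} (R : Composition n) : n.Partition where
  parts := ∑ i ∈ Finset.Icc 1 n, runLengths (levelSet R i)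
  parts_pos := by
    intro k hk
    obtain ⟨i, -, hi⟩ := Multiset.mem_sum.1 hk
    obtain ⟨⟨a, b⟩, hp, rfl⟩ := Multiset.mem_map.1 hi
    have := (mem_runs.1 (show (a, b) ∈ runs (levelSet R i) from hp)).1
    change 0 < b + 1 - a
    omega
  parts_sum := by
    rw [← Multiset.coe_sumAddMonoidHom, map_sum]
    simp only [Multiset.coe_sumAddMonoidHom, sum_runLengths, sum_card_levelSet]

/-- The constant `C_λ = 4 / ∑_p ∑_{s=1}^{λ_p} (λ_p + 1 - 2s)²` of a partition `λ`. -/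
noncomputable def partitionConst {n : ℕ} (lam : n.Partition) : ℝ :=
  4 / (lam.parts.map fun p : ℕ =>
    ∑ s ∈ Finset.Icc 1 p, ((p : ℝ) + 1 - 2 * (s : ℝ)) ^ 2).sum

/-- The squared norm `‖X‖² = tr (X X*)` of a complex square matrix. -/
noncomputable def sqNorm {n : ℕ} (X : Matrix (Fin n) (Fin n) ℂ) : ℝ :=
  (X * X.conjTranspose).trace.re

/-- The function `K(A) = ‖[A, A*]‖² / ‖A‖⁴`, meaningful for `A ≠ 0`. -/
noncomputable def momentK {n : ℕ} (A : Matrix (Fin n) (Fin n) ℂ) : ℝ :=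
  sqNorm ⁅A, A.conjTranspose⁆ / sqNorm A ^ 2

/-- `A` is of type `R = (r_1, …, r_m)` with respect to the decomposition
`ℂⁿ = V_1 ⊕ ⋯ ⊕ V_m`: `dim V_i = r_i`, `A` maps `V_i` into `V_{i+1}`, and `A` kills `V_m`. -/
structure IsOfType {n : ℕ} (R : Composition n) (A : Matrix (Fin n) (Fin n) ℂ)
    (V : Fin R.length → Submodule ℂ (EuclideanSpace ℂ (Fin n))) : Prop where
  isInternal : DirectSum.IsInternal V
  finrank_eq : ∀ i, Module.finrank ℂ (V i) = R.blocksFun i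
  map_mem : ∀ i j : Fin R.length, (j : ℕ) = i + 1 → ∀ x ∈ V i, A.toEuclideanLin x ∈ V j
  map_last : ∀ i : Fin R.length, (i : ℕ) + 1 = R.length → ∀ x ∈ V i, A.toEuclideanLin x = 0

/-- The line `L_j^s` exists and the restriction of `A` to it is nonzero. -/
def NonzeroOnLine {n : ℕ} {R : Composition n} (A : Matrix (Fin n) (Fin n) ℂ)
    (L : ∀ i : Fin R.length, Fin (R.blocksFun i) → Submodule ℂ (EuclideanSpace ℂ (Fin n)))
    (s j : ℕ) : Prop :=
  ∃ (hj : j < R.length) (hs : s < R.blocksFun ⟨j, hj⟩),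
    ∃ x ∈ L ⟨j, hj⟩ ⟨s, hs⟩, A.toEuclideanLin x ≠ 0

/-- `[j₀, j₁]` is the maximal interval of positions containing `i` all of whose consecutive lines
`L_j^s`, `L_{j+1}^s` (`j₀ ≤ j < j₁`) are connected by a nonzero restriction of `A`. -/
structure IsMaximalInterval {n : ℕ} {R : Composition n} (A : Matrix (Fin n) (Fin n) ℂ)
    (L : ∀ i : Fin R.length, Fin (R.blocksFun i) → Submodule ℂ (EuclideanSpace ℂ (Fin n)))
    (s i j₀ j₁ : ℕ) : Prop where
  left_le : j₀ ≤ i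
  le_right : i ≤ j₁
  nonzero : ∀ j, j₀ ≤ j → j < j₁ → NonzeroOnLine A L s j
  left_maximal : ∀ j, j + 1 = j₀ → ¬ NonzeroOnLine A L s j
  right_maximal : ¬ NonzeroOnLine A L s j₁

/-- Each `V_i` is the orthogonal sum of `r_i` lines `L_i^s`; `A` maps `L_i^s` isomorphically onto
`L_{i+1}^s` if the latter exists and is zero on `L_i^s` otherwise; and `L_i^s` is spanned by a unit
vector `v_i^s` such that `A v_i^s = √((i - j₀ + 1)(j₁ - i)) v_{i+1}^s`, where `[j₀, j₁]` is the
maximal interval around `i` on which the lines with index `s` are connected by `A`. -/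
structure IsWeightedLineDecomposition {n : ℕ} (R : Composition n) (A : Matrix (Fin n) (Fin n) ℂ)
    (V : Fin R.length → Submodule ℂ (EuclideanSpace ℂ (Fin n)))
    (L : ∀ i : Fin R.length, Fin (R.blocksFun i) → Submodule ℂ (EuclideanSpace ℂ (Fin n)))
    (v : ∀ i : Fin R.length, Fin (R.blocksFun i) → EuclideanSpace ℂ (Fin n)) : Prop where
  finrank_line : ∀ i s, Module.finrank ℂ (L i s) = 1
  ortho : ∀ i s t, s ≠ t → L i s ⟂ L i t
  iSup_eq : ∀ i, ⨆ s, L i s = V i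
  map_line : ∀ (i j : Fin R.length) (s : Fin (R.blocksFun i)) (t : Fin (R.blocksFun j)),
    (j : ℕ) = i + 1 → (t : ℕ) = s → (L i s).map A.toEuclideanLin = L j t
  map_zero : ∀ (i j : Fin R.length) (s : Fin (R.blocksFun i)),
    (j : ℕ) = i + 1 → R.blocksFun j ≤ s → ∀ x ∈ L i s, A.toEuclideanLin x = 0
  unit_mem : ∀ i s, v i s ∈ L i s
  norm_unit : ∀ i s, ‖v i s‖ = 1
  weight : ∀ (i j : Fin R.length) (s : Fin (R.blocksFun i)) (t : Fin (R.blocksFun j)),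
    (j : ℕ) = i + 1 → (t : ℕ) = s → ∀ j₀ j₁ : ℕ, IsMaximalInterval A L s i j₀ j₁ →
      A.toEuclideanLin (v i s)
        = ((√(((i : ℝ) - j₀ + 1) * ((j₁ : ℝ) - i)) : ℝ) : ℂ) • v j t

/-! The bound is a Cauchy–Schwarz inequality. Suppose that in some orthonormal basis `A` has nonzero
entries only from `x` to `y` with `u x + 2 ≤ u y`. Pairing the diagonal of `[A, A*]` with `u` gives
at least `2‖A‖²`, hence `4‖A‖⁴ ≤ (∑ u²) ‖[A, A*]‖²` (`le_momentK_of_weight`). The right `u` gives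
position `i` of a run `[a, b]` the weight `2i - a - b`, the weights of an irreducible `sl₂`-module;
then `∑ u²` is the denominator of `C_{Rᵗ}`.

To find such a basis, view `A` as a representation of the linear quiver with dimension vector `R`,
which is the sum of the indicators of the runs of all level sets. Level sets are nested, so run
modules do not extend each other. This allows interval-shaped quotients to be split off one by one,
in decreasing order of `a + b` (`exists_filtered_spanning`). In the resulting basis `A` never
increases `a + b`, so it raises the weight by at least 2. Gram–Schmidt in order of decreasing weight
makes the basis orthonormal without losing this (`exists_weighted_orthonormalBasis`).

In (b), `A` acts on each string of lines as the raising operator of `sl₂`. Then `[A, A*]` is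
diagonal with entries `u`, and every inequality above is an equality (`momentK_eq_of_weight`). -/

section Quiver

/-! ### Filtered bases of representations of the linear quiver. -/

variable {K E : Type*} [Field K] [AddCommGroup E] [Module K E]

/-- The map `W → W'/H'` induced by `T` is nonzero with one-dimensional target, so its kernel is a
hyperplane of `W`. -/
theorem comap_inf_covBy {T : E →ₗ[K] E} {W W' H' : Submodule K E} (hH : H' ⋖ W')
    (hT : W ≤ W'.comap T) (hne : ¬ W ≤ H'.comap T) : H'.comap T ⊓ W ⋖ W := by
  refine ⟨lt_of_le_of_ne inf_le_right fun h => hne (inf_eq_right.1 h), ?_⟩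
  intro X hX hXW
  obtain ⟨x, hxX, hx⟩ := SetLike.exists_of_lt hX
  have hxW : x ∈ W := hXW.le hxX
  have hTx : T x ∉ H' := fun h => hx ⟨h, hxW⟩
  have hsup : H' ⊔ Submodule.span K {T x} = W' := by
    refine (hH.eq_or_eq le_sup_left (sup_le hH.le ?_)).resolve_left fun h => hTx ?_
    · rw [Submodule.span_singleton_le_iff_mem]
      exact hT hxW
    · rw [← h]
      exact Submodule.mem_sup_right (Submodule.mem_span_singleton_self _)
  refine hXW.not_ge fun w hw => ?_
  have hTw : T w ∈ H' ⊔ Submodule.span K {T x} := hsup ▸ hT hw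
  obtain ⟨y, hy, z, hz, hyz⟩ := Submodule.mem_sup.1 hTw
  obtain ⟨c, rfl⟩ := Submodule.mem_span_singleton.1 hz
  have h1 : w - c • x ∈ X := hX.le ⟨by simpa [← hyz] using hy, W.sub_mem hw (W.smul_mem c hxW)⟩
  simpa using X.add_mem h1 (X.smul_mem c hxX)

variable [FiniteDimensional K E]

theorem finrank_covBy {H W : Submodule K E} (h : H ⋖ W) :
    Module.finrank K W = Module.finrank K H + 1 := by
  obtain ⟨x, hxW, hx⟩ := SetLike.exists_of_lt h.lt
  rw [← Submodule.finrank_sup_span_singleton hx]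
  rw [(h.eq_or_eq le_sup_left (sup_le h.le ?_)).resolve_left fun h' => hx ?_]
  · rwa [Submodule.span_singleton_le_iff_mem]
  · rw [← h']
    exact Submodule.mem_sup_right (Submodule.mem_span_singleton_self _)

/-- In a representation `W` of the linear quiver, a subrepresentation `M` that is proper at all
positions in `[a, b]` is contained in one that has codimension one at these positions. -/
theorem exists_covBy_chain (T : E →ₗ[K] E) (W M : ℕ → Submodule K E) (b : ℕ)
    (hW : ∀ i, W i ≤ (W (i + 1)).comap T) (d : ℕ) :
    ∀ a, a + d = b → (∀ i, a ≤ i → i ≤ b → M i < W i) →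
      (∀ i, a ≤ i → i < b → M i ≤ (M (i + 1)).comap T) →
      ∃ H : ℕ → Submodule K E, ∀ i, a ≤ i → i ≤ b →
        M i ≤ H i ∧ H i ⋖ W i ∧ (i < b → H i ≤ (H (i + 1)).comap T) := by
  induction d with
  | zero =>
    intro a hab hM _
    obtain ⟨N, hN⟩ := exists_le_covBy_of_lt (hM a le_rfl (by omega))
    refine ⟨fun _ => N, fun i h1 h2 => ?_⟩
    obtain rfl : i = a := by omega
    exact ⟨hN.1, hN.2, fun h => by omega⟩
  | succ d ih =>
    intro a hab hM hTM
    obtain ⟨H, hH⟩ := ih (a + 1) (by omega) (fun i h1 h2 => hM i (by omega) h2)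
      (fun i h1 h2 => hTM i (by omega) h2)
    obtain ⟨h1, h2, -⟩ := hH (a + 1) le_rfl (by omega)
    obtain ⟨N, hMN, hN, hTN⟩ : ∃ N, M a ≤ N ∧ N ⋖ W a ∧ N ≤ (H (a + 1)).comap T := by
      -- The hyperplanes are chosen from right to left. Either `T` imposes no condition at `a`, or
      -- the preimage of the next hyperplane is forced.
      by_cases hle : W a ≤ (H (a + 1)).comap T
      · obtain ⟨N, hN⟩ := exists_le_covBy_of_lt (hM a le_rfl (by omega))
        exact ⟨N, hN.1, hN.2, hN.2.le.trans hle⟩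
      · refine ⟨_, ?_, comap_inf_covBy h2 (hW a) hle, inf_le_left⟩
        exact le_inf ((hTM a le_rfl (by omega)).trans (Submodule.comap_mono h1))
          (hM a le_rfl (by omega)).le
    refine ⟨Function.update H a N, fun i hi hib => ?_⟩
    rw [Function.update_of_ne (show i + 1 ≠ a by omega)]
    rcases eq_or_ne i a with rfl | hne
    · rw [Function.update_self]
      exact ⟨hMN, hN, fun _ => hTN⟩
    · rw [Function.update_of_ne hne]
      exact hH i (by omega) hib

/-- Produces a quotient representation of dimension one exactly on `[a, b]`. The only obstruction is
that `H` must contain everything arriving from position `a - 1`; `hr` makes those images proper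
subspaces throughout `[a, b]`. -/
theorem exists_codim_one_subrep (T : E →ₗ[K] E) (W : ℕ → Submodule K E) {a b : ℕ} (hab : a ≤ b)
    (hW : ∀ i, W i ≤ (W (i + 1)).comap T) (hpos : ∀ i, a ≤ i → i ≤ b → 0 < Module.finrank K (W i))
    (hr : ∀ c i, c + 1 = a → a ≤ i → i ≤ b → Module.finrank K (W c) < Module.finrank K (W i)) :
    ∃ H : ℕ → Submodule K E, (∀ i, H i ≤ (H (i + 1)).comap T) ∧
      (∀ i, a ≤ i → i ≤ b → H i ⋖ W i) ∧ ∀ i, ¬ (a ≤ i ∧ i ≤ b) → H i = W i := by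
  obtain ⟨M, hM, hTM, hMa⟩ : ∃ M : ℕ → Submodule K E, (∀ i, a ≤ i → i ≤ b → M i < W i) ∧
      (∀ i, a ≤ i → i < b → M i ≤ (M (i + 1)).comap T) ∧
      ∀ c, c + 1 = a → W c ≤ (M a).comap T := by
    rcases a with _ | c
    · refine ⟨fun _ => ⊥, fun i h1 h2 => bot_lt_iff_ne_bot.2 fun h => ?_, by simp, by simp⟩
      have := hpos i h1 h2
      rw [h, finrank_bot] at this
      omega
    · have hle : ∀ k, (W c).map (T ^ k) ≤ W (c + k) := by
        intro k
        induction k with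
        | zero => simp [Module.End.one_eq_id]
        | succ k ih =>
          rw [pow_succ', Module.End.mul_eq_comp, Submodule.map_comp]
          exact (Submodule.map_mono ih).trans (Submodule.map_le_iff_le_comap.2 (hW _))
      refine ⟨fun i => (W c).map (T ^ (i - c)), fun i h1 h2 => ?_, fun i h1 h2 => ?_, ?_⟩
      · refine lt_of_le_of_ne ?_ fun h => ?_
        · simpa [show c + (i - c) = i by omega] using hle (i - c)
        · have h3 := hr c i rfl h1 h2
          rw [← h] at h3
          exact h3.not_ge (Submodule.finrank_map_le _ _)
      · rw [← Submodule.map_le_iff_le_comap, ← Submodule.map_comp, ← Module.End.mul_eq_comp,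
          ← pow_succ', show i - c + 1 = i + 1 - c by omega]
      · intro c' hc'
        obtain rfl : c' = c := by omega
        rw [← Submodule.map_le_iff_le_comap]
        simp
  obtain ⟨H, hH⟩ := exists_covBy_chain T W M b hW (b - a) a (by omega) hM hTM
  refine ⟨fun i => if a ≤ i ∧ i ≤ b then H i else W i, fun i => ?_, fun i h1 h2 => ?_,
    fun i h => if_neg h⟩
  · by_cases hi : a ≤ i ∧ i ≤ b <;> by_cases hi' : a ≤ i + 1 ∧ i + 1 ≤ b
    · simp only [if_pos hi, if_pos hi']
      exact (hH i hi.1 hi.2).2.2 (by omega)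
    · simp only [if_pos hi, if_neg hi']
      exact (hH i hi.1 hi.2).2.1.le.trans (hW i)
    · simp only [if_neg hi, if_pos hi']
      obtain rfl : a = i + 1 := by omega
      exact (hMa i rfl).trans (Submodule.comap_mono (hH _ hi'.1 hi'.2).1)
    · simp only [if_neg hi, if_neg hi']
      exact hW i
  · simp only [if_pos (And.intro h1 h2)]
    exact (hH i h1 h2).2.1

/-- A representation `W` of the linear quiver whose dimension vector is the sum of the indicator
vectors of intervals `[a p, b p]`, no two of which have a nontrivial extension, has a basis indexed
by the points of the intervals which `T` maps compatibly with the ordering by `a p + b p`. -/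
theorem exists_filtered_spanning {ι : Type*} [DecidableEq ι] (T : E →ₗ[K] E) (a b : ι → ℕ)
    (I : Finset ι) :
    (∀ p ∈ I, a p ≤ b p) →
    (∀ p ∈ I, ∀ q ∈ I, a q < a p → a p ≤ b q + 1 → b p ≤ b q) →
    ∀ W : ℕ → Submodule K E, (∀ i, W i ≤ (W (i + 1)).comap T) →
    (∀ i, Module.finrank K (W i) = (I.filter fun p => a p ≤ i ∧ i ≤ b p).card) →
    ∃ f : ι → ℕ → E,
      (∀ i, Submodule.span K ((f · i) '' {p | p ∈ I ∧ a p ≤ i ∧ i ≤ b p}) = W i) ∧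
      ∀ p ∈ I, ∀ i, a p ≤ i → i ≤ b p → T (f p i) ∈ Submodule.span K
        ((f · (i + 1)) '' {q | q ∈ I ∧ (a q ≤ i + 1 ∧ i + 1 ≤ b q) ∧ a q + b q ≤ a p + b p}) := by
  refine Finset.induction_on_max_value (fun p => a p + b p) I ?_ ?_
  · intro _ _ W _ hr
    refine ⟨fun _ _ => 0, fun i => ?_, by simp⟩
    have := hr i
    simp only [Finset.filter_empty, Finset.card_empty, Submodule.finrank_eq_zero] at this
    simp [this]
  · intro p I hp hmax ih hab hcompat W hW hr
    obtain ⟨H, hTH, hHW, hHW'⟩ := exists_codim_one_subrep T W (hab p (Finset.mem_insert_self _ _)) hW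
      (fun i h1 h2 => by
        rw [hr, Finset.card_pos]
        exact ⟨p, Finset.mem_filter.2 ⟨Finset.mem_insert_self _ _, h1, h2⟩⟩)
      (fun c i hc h1 h2 => by
        rw [hr, hr]
        refine Finset.card_lt_card ((Finset.ssubset_iff_of_subset ?_).2 ⟨p, ?_, ?_⟩)
        · intro q hq
          obtain ⟨hqI, hq1, hq2⟩ := Finset.mem_filter.1 hq
          -- An interval through `a p - 1` must reach `b p`, so it also contains `i`. The interval
          -- `p` contains `i` but not `a p - 1`, which makes the inclusion strict.
          have := hcompat p (Finset.mem_insert_self _ _) q hqI (by omega) (by omega)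
          exact Finset.mem_filter.2 ⟨hqI, by omega, by omega⟩
        · exact Finset.mem_filter.2 ⟨Finset.mem_insert_self _ _, h1, h2⟩
        · intro h
          have := (Finset.mem_filter.1 h).2.1
          omega)
    obtain ⟨f, hspan, hT⟩ := ih (fun q hq => hab q (Finset.mem_insert_of_mem hq))
      (fun q hq q' hq' => hcompat q (Finset.mem_insert_of_mem hq) q' (Finset.mem_insert_of_mem hq'))
      H hTH (fun i => by
        have h1 := hr i
        rw [Finset.filter_insert] at h1
        by_cases hi : a p ≤ i ∧ i ≤ b p
        · rw [if_pos hi, Finset.card_insert_of_notMem (fun h => hp (Finset.mem_filter.1 h).1),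
            finrank_covBy (hHW i hi.1 hi.2)] at h1
          omega
        · rw [if_neg hi] at h1
          rw [hHW' i hi, h1])
    -- The new basis vectors are lifts of generators of the one-dimensional quotients `W i / H i`.
    have hg : ∀ i, ∃ x, a p ≤ i → i ≤ b p → x ∈ W i ∧ x ∉ H i := by
      intro i
      by_cases hi : a p ≤ i ∧ i ≤ b p
      · obtain ⟨x, h1, h2⟩ := SetLike.exists_of_lt (hHW i hi.1 hi.2).lt
        exact ⟨x, fun _ _ => ⟨h1, h2⟩⟩
      · exact ⟨0, fun h1 h2 => absurd ⟨h1, h2⟩ hi⟩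
    choose g hg using hg
    have hne : ∀ q ∈ I, q ≠ p := fun q hq h => hp (h ▸ hq)
    have hold : ∀ (i : ℕ) (S : Set ι), S ⊆ I →
        (fun q => Function.update f p g q i) '' S = (f · i) '' S := by
      intro i S hS
      refine Set.image_congr fun q hq => ?_
      simp only [Function.update_of_ne (hne q (hS hq))]
    have hspan' : ∀ i, Submodule.span K ((fun q => Function.update f p g q i) ''
        {q | q ∈ insert p I ∧ a q ≤ i ∧ i ≤ b q}) = W i := by
      intro i
      by_cases hi : a p ≤ i ∧ i ≤ b p
      · have hset : {q | q ∈ insert p I ∧ a q ≤ i ∧ i ≤ b q}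
            = insert p {q | q ∈ I ∧ a q ≤ i ∧ i ≤ b q} := by
          ext q
          simp only [Finset.mem_insert, Set.mem_ofPred_eq, Set.mem_insert_iff]
          constructor
          · rintro ⟨rfl | h, h'⟩
            · exact Or.inl rfl
            · exact Or.inr ⟨h, h'⟩
          · rintro (rfl | h)
            · exact ⟨Or.inl rfl, hi⟩
            · exact ⟨Or.inr h.1, h.2⟩
        rw [hset, Set.image_insert_eq, Function.update_self, Submodule.span_insert,
          hold i _ (fun q hq => hq.1), hspan i]
        obtain ⟨h1, h2⟩ := hg i hi.1 hi.2
        refine ((hHW i hi.1 hi.2).eq_or_eq le_sup_right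
          (sup_le ?_ (hHW i hi.1 hi.2).le)).resolve_left fun h => h2 ?_
        · rwa [Submodule.span_singleton_le_iff_mem]
        · rw [← h]
          exact Submodule.mem_sup_left (Submodule.mem_span_singleton_self _)
      · have hset : {q | q ∈ insert p I ∧ a q ≤ i ∧ i ≤ b q}
            = {q | q ∈ I ∧ a q ≤ i ∧ i ≤ b q} := by
          ext q
          simp only [Finset.mem_insert, Set.mem_ofPred_eq]
          constructor
          · rintro ⟨rfl | h, h'⟩
            · exact absurd h' hi
            · exact ⟨h, h'⟩
          · exact fun h => ⟨Or.inr h.1, h.2⟩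
        rw [hset, hold i _ (fun q hq => hq.1), hspan i, hHW' i hi]
    refine ⟨Function.update f p g, hspan', fun q hq i h1 h2 => ?_⟩
    rcases Finset.mem_insert.1 hq with rfl | hqI
    · rw [Function.update_self]
      -- Since `a p + b p` is maximal, any vector of `W (i + 1)` is an allowed image. The older
      -- vectors stay in the subrepresentation `H`.
      have h3 := hW i (hg i h1 h2).1
      rw [Submodule.mem_comap, ← hspan' (i + 1)] at h3
      refine Submodule.span_mono (Set.image_mono ?_) h3
      rintro r ⟨hr1, hr2⟩
      refine ⟨hr1, hr2, ?_⟩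
      rcases Finset.mem_insert.1 hr1 with rfl | hrI
      · exact le_rfl
      · exact hmax r hrI
    · rw [Function.update_of_ne (hne q hqI)]
      have h3 := hT q hqI i h1 h2
      rw [← hold (i + 1) _ (fun q hq => hq.1)] at h3
      refine Submodule.span_mono (Set.image_mono ?_) h3
      rintro r ⟨hr1, hr2⟩
      exact ⟨Finset.mem_insert_of_mem hr1, hr2⟩

end Quiver
-- Orthonormalization compatible with the weights.
section Orthonormal

variable {E : Type*} [NormedAddCommGroup E] [InnerProductSpace ℂ E] [FiniteDimensional ℂ E]

/-- `T` shifts the filtration by weight, and Gram–Schmidt along that filtration preserves its steps.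
Only the filtration is used, so the summands `V_i` need not be orthogonal. -/
theorem exists_weighted_orthonormalBasis {X : Type*} [Fintype X] (T : E →ₗ[ℂ] E) (f : X → E)
    (w : X → ℤ) (hf : ⊤ ≤ Submodule.span ℂ (Set.range f)) {n : ℕ} (hX : Fintype.card X = n)
    (hn : Module.finrank ℂ E = n)
    (hT : ∀ x, T (f x) ∈ Submodule.span ℂ (f '' {y | w x + 2 ≤ w y})) :
    ∃ (e : OrthonormalBasis (Fin n) ℂ E) (σ : Fin n ≃ X),
      ∀ x y, inner ℂ (e y) (T (e x)) ≠ 0 → w (σ x) + 2 ≤ w (σ y) := by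
  let τ : Fin n ≃ X := (Fintype.equivFinOfCardEq hX).symm
  -- The sign puts the largest weights first, so initial segments span the steps of the filtration.
  let σ : Fin n ≃ X := (Tuple.sort fun k => - w (τ k)).trans τ
  have hσ : ∀ x y, x ≤ y → w (σ y) ≤ w (σ x) := fun x y hxy =>
    neg_le_neg_iff.1 (Tuple.monotone_sort (fun k => - w (τ k)) hxy)
  have hli : LinearIndependent ℂ (f ∘ σ) :=
    linearIndependent_of_top_le_span_of_card_eq_finrank
      (by rwa [Set.range_comp, σ.range_eq_univ, Set.image_univ]) (by simp [hn])
  have hcard : Module.finrank ℂ E = Fintype.card (Fin n) := by simp [hn]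
  refine ⟨InnerProductSpace.gramSchmidtOrthonormalBasis hcard (f ∘ σ), σ, fun x y hxy => ?_⟩
  by_contra hlt
  refine hxy ?_
  set e := InnerProductSpace.gramSchmidtOrthonormalBasis hcard (f ∘ σ) with he
  have hex : e x ∈ Submodule.span ℂ (f ∘ σ '' Set.Iic x) := by
    have hne : InnerProductSpace.gramSchmidtNormed ℂ (f ∘ σ) x ≠ 0 := fun h => by
      have := InnerProductSpace.gramSchmidtNormed_unit_length x hli
      simp [h] at this
    rw [he, InnerProductSpace.gramSchmidtOrthonormalBasis_apply hcard hne,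
      ← InnerProductSpace.span_gramSchmidt_Iic, ← InnerProductSpace.span_gramSchmidtNormed]
    exact Submodule.subset_span ⟨x, Set.mem_Iic.2 le_rfl, rfl⟩
  have hTe : T (e x) ∈ Submodule.span ℂ (f '' {z | w (σ x) + 2 ≤ w z}) := by
    refine (Submodule.span_le (p := (Submodule.span ℂ _).comap T)).2 ?_ hex
    rintro _ ⟨z, hz, rfl⟩
    refine Submodule.span_mono (Set.image_mono ?_) (hT (σ z))
    intro t ht
    exact (add_le_add_left (hσ z x hz) 2).trans ht
  -- Under `hlt` these vectors weigh more than `σ y`, hence precede it, and `e y` is orthogonal to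
  -- all of them.
  have hker : Submodule.span ℂ (f '' {z | w (σ x) + 2 ≤ w z})
      ≤ LinearMap.ker (innerSL ℂ (e y)).toLinearMap := by
    rw [Submodule.span_le]
    rintro _ ⟨z, hz, rfl⟩
    have hzy : σ.symm z < y := by
      by_contra h
      have := hσ y (σ.symm z) (not_lt.1 h)
      rw [σ.apply_symm_apply] at this
      exact hlt (le_trans hz this)
    have := InnerProductSpace.gramSchmidtOrthonormalBasis_inv_triangular hcard (f ∘ σ) hzy
    simpa using this
  simpa using hker hTe

end Orthonormal

/-! ### The function `K` and Cauchy–Schwarz with weights. -/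

section Moment

variable {n : ℕ}

theorem sqNorm_eq_sum (X : Matrix (Fin n) (Fin n) ℂ) : sqNorm X = ∑ i, ∑ j, ‖X i j‖ ^ 2 := by
  simp only [sqNorm, Matrix.trace, Matrix.diag, Matrix.mul_apply, Matrix.conjTranspose_apply,
    Complex.re_sum]
  refine Finset.sum_congr rfl fun i _ => Finset.sum_congr rfl fun j _ => ?_
  rw [← Complex.normSq_eq_norm_sq, RCLike.star_def, Complex.mul_conj, Complex.ofReal_re]

theorem sqNorm_pos {X : Matrix (Fin n) (Fin n) ℂ} (hX : X ≠ 0) : 0 < sqNorm X := by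
  rw [sqNorm_eq_sum]
  refine lt_of_le_of_ne (by positivity) fun h => hX ?_
  ext i j
  rw [eq_comm, Finset.sum_eq_zero_iff_of_nonneg fun _ _ => by positivity] at h
  have := (Finset.sum_eq_zero_iff_of_nonneg fun _ _ => by positivity).1 (h i (Finset.mem_univ i)) j
    (Finset.mem_univ j)
  simpa using this

theorem sqNorm_unitary_conj {U : Matrix (Fin n) (Fin n) ℂ} (hU : U ∈ Matrix.unitaryGroup (Fin n) ℂ)
    (X : Matrix (Fin n) (Fin n) ℂ) : sqNorm (U.conjTranspose * X * U) = sqNorm X := by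
  have h1 : U * U.conjTranspose = 1 := Matrix.mem_unitaryGroup_iff.1 hU
  rw [sqNorm, sqNorm]
  congr 1
  rw [Matrix.conjTranspose_mul, Matrix.conjTranspose_mul, Matrix.conjTranspose_conjTranspose]
  calc (U.conjTranspose * X * U * (U.conjTranspose * (X.conjTranspose * U))).trace
      = (U.conjTranspose * (X * (U * U.conjTranspose) * X.conjTranspose * U)).trace := by
        simp only [Matrix.mul_assoc]
    _ = _ := by
        rw [h1, Matrix.mul_one, Matrix.trace_mul_comm, Matrix.mul_assoc, h1, Matrix.mul_one]

theorem momentK_unitary_conj {U : Matrix (Fin n) (Fin n) ℂ}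
    (hU : U ∈ Matrix.unitaryGroup (Fin n) ℂ) (X : Matrix (Fin n) (Fin n) ℂ) :
    momentK (U.conjTranspose * X * U) = momentK X := by
  have h1 : U * U.conjTranspose = 1 := Matrix.mem_unitaryGroup_iff.1 hU
  have h2 : ⁅U.conjTranspose * X * U, (U.conjTranspose * X * U).conjTranspose⁆
      = U.conjTranspose * ⁅X, X.conjTranspose⁆ * U := by
    rw [Ring.lie_def, Ring.lie_def, Matrix.conjTranspose_mul, Matrix.conjTranspose_mul,
      Matrix.conjTranspose_conjTranspose]
    calc _ = U.conjTranspose * X * (U * U.conjTranspose) * X.conjTranspose * U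
          - U.conjTranspose * X.conjTranspose * (U * U.conjTranspose) * X * U := by
          simp only [Matrix.mul_assoc]
      _ = _ := by
          rw [h1]
          simp only [Matrix.mul_one, Matrix.mul_sub, Matrix.sub_mul, Matrix.mul_assoc]
  rw [momentK, momentK, h2, sqNorm_unitary_conj hU, sqNorm_unitary_conj hU]

/-- Conjugation by a unitary matrix expresses `A` in an orthonormal basis. -/
theorem exists_unitary_conj_apply (e : OrthonormalBasis (Fin n) ℂ (EuclideanSpace ℂ (Fin n)))
    (A : Matrix (Fin n) (Fin n) ℂ) :
    ∃ U ∈ Matrix.unitaryGroup (Fin n) ℂ, ∀ x y,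
      (U.conjTranspose * A * U) x y = inner ℂ (e x) (A.toEuclideanLin (e y)) := by
  refine ⟨Matrix.of fun i x => e x i, ?_, fun x y => ?_⟩
  · rw [Matrix.mem_unitaryGroup_iff']
    ext x y
    have := orthonormal_iff_ite.1 e.orthonormal x y
    rw [Matrix.one_apply, ← this, PiLp.inner_apply]
    simp [Matrix.mul_apply, Matrix.star_eq_conjTranspose, mul_comm]
  · rw [PiLp.inner_apply, Matrix.mul_assoc]
    simp [Matrix.mul_apply, Matrix.mulVec, dotProduct, mul_comm]

theorem commutator_diag_re (B : Matrix (Fin n) (Fin n) ℂ) (x : Fin n) :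
    (⁅B, B.conjTranspose⁆ x x).re = ∑ y, ‖B x y‖ ^ 2 - ∑ y, ‖B y x‖ ^ 2 := by
  rw [Ring.lie_def, Matrix.sub_apply, Matrix.mul_apply, Matrix.mul_apply, Complex.sub_re,
    Complex.re_sum, Complex.re_sum]
  congr 1
  · refine Finset.sum_congr rfl fun j _ => ?_
    rw [← Complex.normSq_eq_norm_sq, Matrix.conjTranspose_apply, RCLike.star_def,
      Complex.mul_conj, Complex.ofReal_re]
  · refine Finset.sum_congr rfl fun j _ => ?_
    rw [← Complex.normSq_eq_norm_sq, Matrix.conjTranspose_apply, RCLike.star_def, mul_comm,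
      Complex.mul_conj, Complex.ofReal_re]

/-- With `D = diag(u)` this is `tr(D[B, B*]) = tr([D, B]B*)`, and `[D, B]` has entries `(u x - u y)
B x y`. -/
theorem sum_weight_mul_commutator_diag (B : Matrix (Fin n) (Fin n) ℂ) (u : Fin n → ℝ) :
    ∑ x, u x * (⁅B, B.conjTranspose⁆ x x).re = ∑ x, ∑ y, (u x - u y) * ‖B x y‖ ^ 2 := by
  simp only [commutator_diag_re, mul_sub, sub_mul, Finset.sum_sub_distrib, Finset.mul_sum]
  congr 1
  exact Finset.sum_comm

theorem le_momentK_of_weight {A : Matrix (Fin n) (Fin n) ℂ} (hA : A ≠ 0)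
    (e : OrthonormalBasis (Fin n) ℂ (EuclideanSpace ℂ (Fin n))) (u : Fin n → ℝ)
    (hu : ∀ x y, inner ℂ (e y) (A.toEuclideanLin (e x)) ≠ 0 → u x + 2 ≤ u y) :
    4 / ∑ x, u x ^ 2 ≤ momentK A := by
  obtain ⟨U, hU, hUA⟩ := exists_unitary_conj_apply e A
  set B := U.conjTranspose * A * U with hB
  have hpos : 0 < sqNorm B := by
    rw [sqNorm_unitary_conj hU]
    exact sqNorm_pos hA
  rw [← momentK_unitary_conj hU, ← hB, momentK]
  have h1 : 2 * sqNorm B ≤ ∑ x, u x * (⁅B, B.conjTranspose⁆ x x).re := by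
    rw [sum_weight_mul_commutator_diag, sqNorm_eq_sum, Finset.mul_sum]
    refine Finset.sum_le_sum fun x _ => ?_
    rw [Finset.mul_sum]
    refine Finset.sum_le_sum fun y _ => ?_
    by_cases h : B x y = 0
    · simp [h]
    · have := hu y x (by rwa [← hUA])
      exact mul_le_mul_of_nonneg_right (by linarith) (by positivity)
  have h2 := Finset.sum_mul_sq_le_sq_mul_sq Finset.univ u fun x => (⁅B, B.conjTranspose⁆ x x).re
  have h3 : ∑ x, (⁅B, B.conjTranspose⁆ x x).re ^ 2 ≤ sqNorm ⁅B, B.conjTranspose⁆ := by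
    rw [sqNorm_eq_sum]
    refine Finset.sum_le_sum fun x _ => ?_
    refine le_trans ?_ (Finset.single_le_sum (f := fun j => ‖⁅B, B.conjTranspose⁆ x j‖ ^ 2)
      (fun _ _ => by positivity) (Finset.mem_univ x))
    rw [← sq_abs]
    exact pow_le_pow_left₀ (abs_nonneg _) (Complex.abs_re_le_norm _) 2
  -- Cauchy–Schwarz; since `sqNorm B > 0`, this also forces `∑ u² > 0`.
  have h4 : (2 * sqNorm B) ^ 2 ≤ (∑ x, u x ^ 2) * sqNorm ⁅B, B.conjTranspose⁆ :=
    (pow_le_pow_left₀ (by positivity) h1 2).trans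
      (h2.trans (mul_le_mul_of_nonneg_left h3 (Finset.sum_nonneg fun _ _ => sq_nonneg _)))
  have hS : 0 < ∑ x, u x ^ 2 := by
    refine lt_of_le_of_ne (Finset.sum_nonneg fun _ _ => sq_nonneg _) fun h => ?_
    rw [← h] at h4
    nlinarith [pow_pos hpos 2]
  rw [div_le_div_iff₀ hS (by positivity)]
  linarith

/-- The equality case. `hrow` and `hcol` leave at most one nonzero entry in each column and row, so
the commutator is diagonal, and by `hdiag` it equals `diag(u)`. Both `2‖A‖²` and `‖[A, A*]‖²` are
then `∑ u²`. -/
theorem momentK_eq_of_weight {A : Matrix (Fin n) (Fin n) ℂ} (hA : A ≠ 0)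
    (e : OrthonormalBasis (Fin n) ℂ (EuclideanSpace ℂ (Fin n))) (u : Fin n → ℝ)
    (hu : ∀ x y, inner ℂ (e y) (A.toEuclideanLin (e x)) ≠ 0 → u x + 2 = u y)
    (hrow : ∀ x y z, inner ℂ (e x) (A.toEuclideanLin (e z)) ≠ 0 →
      inner ℂ (e y) (A.toEuclideanLin (e z)) ≠ 0 → x = y)
    (hcol : ∀ x y z, inner ℂ (e z) (A.toEuclideanLin (e x)) ≠ 0 →
      inner ℂ (e z) (A.toEuclideanLin (e y)) ≠ 0 → x = y)
    (hdiag : ∀ x, ∑ y, ‖inner ℂ (e x) (A.toEuclideanLin (e y))‖ ^ 2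
      - ∑ y, ‖inner ℂ (e y) (A.toEuclideanLin (e x))‖ ^ 2 = u x) :
    momentK A = 4 / ∑ x, u x ^ 2 := by
  obtain ⟨U, hU, hUA⟩ := exists_unitary_conj_apply e A
  set B := U.conjTranspose * A * U with hB
  have hpos : 0 < sqNorm B := by
    rw [sqNorm_unitary_conj hU]
    exact sqNorm_pos hA
  rw [← momentK_unitary_conj hU, ← hB, momentK]
  simp only [← hUA] at hu hrow hcol hdiag
  have hd : ∀ x, (⁅B, B.conjTranspose⁆ x x).re = u x := fun x => by
    rw [commutator_diag_re, hdiag]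
  have him : ∀ x, (⁅B, B.conjTranspose⁆ x x).im = 0 := fun x => by
    rw [Ring.lie_def, Matrix.sub_apply, Matrix.mul_apply, Matrix.mul_apply, Complex.sub_im,
      Complex.im_sum, Complex.im_sum]
    simp [mul_comm]
  have hoff : ∀ x y, x ≠ y → ⁅B, B.conjTranspose⁆ x y = 0 := fun x y hxy => by
    rw [Ring.lie_def, Matrix.sub_apply, Matrix.mul_apply, Matrix.mul_apply,
      Finset.sum_eq_zero, Finset.sum_eq_zero, sub_zero]
    · intro z _
      by_contra h
      simp only [Matrix.conjTranspose_apply, mul_eq_zero, star_eq_zero, not_or] at h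
      exact hxy (hcol x y z h.1 h.2)
    · intro z _
      by_contra h
      simp only [Matrix.conjTranspose_apply, mul_eq_zero, star_eq_zero, not_or] at h
      exact hxy (hrow x y z h.1 h.2)
  have h1 : 2 * sqNorm B = ∑ x, u x ^ 2 := by
    have h := sum_weight_mul_commutator_diag B u
    simp only [hd, ← sq] at h
    rw [h, sqNorm_eq_sum, Finset.mul_sum]
    refine Finset.sum_congr rfl fun x _ => ?_
    rw [Finset.mul_sum]
    refine Finset.sum_congr rfl fun y _ => ?_
    by_cases h : B x y = 0
    · simp [h]
    · rw [← hu y x h]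
      ring
  have h2 : sqNorm ⁅B, B.conjTranspose⁆ = ∑ x, u x ^ 2 := by
    rw [sqNorm_eq_sum]
    refine Finset.sum_congr rfl fun x _ => ?_
    rw [Finset.sum_eq_single x (fun y _ hyx => by rw [hoff x y hyx.symm]; simp) (by simp),
      ← Complex.normSq_eq_norm_sq, Complex.normSq_apply, him, hd]
    ring
  rw [h2, ← h1]
  field_simp
  ring

end Moment
-- Runs of the level sets and their weights.
section Runs

theorem mem_levelSet {n : ℕ} {R : Composition n} {l i : ℕ} :
    i ∈ levelSet R l ↔ ∃ h : i < R.length, l ≤ R.blocksFun ⟨i, h⟩ := by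
  simp only [levelSet, Finset.mem_map, Finset.mem_filter, Finset.mem_univ, true_and]
  constructor
  · rintro ⟨j, hj, rfl⟩
    exact ⟨j.2, hj⟩
  · rintro ⟨h, hl⟩
    exact ⟨⟨i, h⟩, hl, rfl⟩

theorem levelSet_anti {n : ℕ} (R : Composition n) {k l : ℕ} (h : k ≤ l) :
    levelSet R l ⊆ levelSet R k := fun _ hi =>
  let ⟨hi, hl⟩ := mem_levelSet.1 hi
  mem_levelSet.2 ⟨hi, h.trans hl⟩

theorem blocksFun_le_self {n : ℕ} (R : Composition n) (j : Fin R.length) : R.blocksFun j ≤ n := by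
  conv_rhs => rw [← R.sum_blocksFun]
  exact Finset.single_le_sum (f := R.blocksFun) (fun _ _ => Nat.zero_le _) (Finset.mem_univ j)

/-- This is the vanishing of extensions between runs. The point just before `p` lies in `T'` but not
in `T`, so `T ⊆ T'`; then `q` cannot stop inside `p`. -/
theorem run_le_of_adjacent {T T' : Finset ℕ} (hTT : T ⊆ T' ∨ T' ⊆ T) {p q : ℕ × ℕ}
    (hp : p ∈ runs T) (hq : q ∈ runs T') (h1 : q.1 < p.1) (h2 : p.1 ≤ q.2 + 1) : p.2 ≤ q.2 := by
  obtain ⟨a, b⟩ := p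
  obtain ⟨c, d⟩ := q
  obtain ⟨hab, hT, ha, -⟩ := mem_runs.1 hp
  obtain ⟨-, hT', -, hd⟩ := mem_runs.1 hq
  simp only at h1 h2 ⊢
  have hmem : a - 1 ∈ T' := hT' (Finset.mem_Icc.2 ⟨by omega, by omega⟩)
  have hsub : T ⊆ T' := hTT.resolve_right fun h => ha _ (h hmem) (by omega)
  by_contra hlt
  exact hd (hsub (hT (Finset.mem_Icc.2 ⟨by omega, by omega⟩)))

/-- The run of `T` containing `j`. -/
noncomputable def runAt (T : Finset ℕ) (j : ℕ) : ℕ × ℕ :=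
  if h : j ∈ T then (exists_run h).choose else (0, 0)

theorem runAt_mem {T : Finset ℕ} {j : ℕ} (h : j ∈ T) : runAt T j ∈ runs T := by
  rw [runAt, dif_pos h]
  exact (exists_run h).choose_spec.1

theorem mem_runAt {T : Finset ℕ} {j : ℕ} (h : j ∈ T) :
    j ∈ Finset.Icc (runAt T j).1 (runAt T j).2 := by
  rw [runAt, dif_pos h]
  exact (exists_run h).choose_spec.2

theorem mem_of_mem_run {T : Finset ℕ} {p : ℕ × ℕ} (hp : p ∈ runs T) {j : ℕ}
    (hj : j ∈ Finset.Icc p.1 p.2) : j ∈ T :=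
  (mem_runs.1 (show (p.1, p.2) ∈ runs T from hp)).2.1 hj

theorem runAt_eq {T : Finset ℕ} {p : ℕ × ℕ} (hp : p ∈ runs T) {j : ℕ}
    (hj : j ∈ Finset.Icc p.1 p.2) : runAt T j = p :=
  have h := mem_of_mem_run hp hj
  run_unique (runAt_mem h) hp (mem_runAt h) hj

theorem runAt_succ {T : Finset ℕ} {j : ℕ} (h : j ∈ T) (h' : j + 1 ∈ T) :
    runAt T (j + 1) = runAt T j := by
  refine runAt_eq (runAt_mem h) ?_
  have h1 := Finset.mem_Icc.1 (mem_runAt h)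
  have h2 : (runAt T j).2 + 1 ∉ T :=
    (mem_runs.1 (show ((runAt T j).1, (runAt T j).2) ∈ runs T from runAt_mem h)).2.2.2
  have h3 : (runAt T j).2 ≠ j := fun h4 => h2 (by rwa [h4])
  exact Finset.mem_Icc.2 ⟨by omega, by omega⟩

theorem sum_runs {M : Type*} [AddCommMonoid M] (T : Finset ℕ) (F : ℕ × ℕ → ℕ → M) :
    ∑ p ∈ runs T, ∑ j ∈ Finset.Icc p.1 p.2, F p j = ∑ j ∈ T, F (runAt T j) j := by
  rw [Finset.sum_sigma']
  refine Finset.sum_bij' (fun x _ => x.2) (fun j _ => ⟨runAt T j, j⟩) ?_ ?_ ?_ ?_ ?_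
  · intro x hx
    obtain ⟨h1, h2⟩ := Finset.mem_sigma.1 hx
    exact mem_of_mem_run h1 h2
  · intro j hj
    exact Finset.mem_sigma.2 ⟨runAt_mem hj, mem_runAt hj⟩
  · rintro ⟨p, j⟩ hx
    obtain ⟨h1, h2⟩ := Finset.mem_sigma.1 hx
    simp only at h1 h2 ⊢
    rw [runAt_eq h1 h2]
  · intro j _
    rfl
  · rintro ⟨p, j⟩ hx
    obtain ⟨h1, h2⟩ := Finset.mem_sigma.1 hx
    simp only at h1 h2 ⊢
    rw [runAt_eq h1 h2]

theorem sum_levelSet {M : Type*} [AddCommMonoid M] {n : ℕ} (R : Composition n) (F : ℕ → ℕ → M) :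
    ∑ l ∈ Finset.Icc 1 n, ∑ j ∈ levelSet R l, F l j
      = ∑ x : (i : Fin R.length) × Fin (R.blocksFun i), F (x.2 + 1) x.1 := by
  simp only [levelSet, Finset.sum_map, Finset.sum_filter]
  rw [Finset.sum_comm, Fintype.sum_sigma]
  refine Finset.sum_congr rfl fun j _ => ?_
  rw [← Finset.sum_filter, Fin.sum_univ_eq_sum_range (fun s => F (s + 1) j)]
  have hj := blocksFun_le_self R j
  refine Finset.sum_bij' (fun l _ => l - 1) (fun s _ => s + 1) ?_ ?_ ?_ ?_ ?_
  · intro l hl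
    simp only [Finset.mem_filter, Finset.mem_Icc, Finset.mem_range] at hl ⊢
    omega
  · intro s hs
    simp only [Finset.mem_filter, Finset.mem_Icc, Finset.mem_range] at hs ⊢
    omega
  · intro l hl
    simp only [Finset.mem_filter, Finset.mem_Icc] at hl
    omega
  · intro s _
    simp
  · intro l hl
    simp only [Finset.mem_filter, Finset.mem_Icc] at hl
    rw [show l - 1 + 1 = l by omega]
    rfl

theorem card_filter_runs (T : Finset ℕ) (i : ℕ) :
    ((runs T).filter fun p => p.1 ≤ i ∧ i ≤ p.2).card = if i ∈ T then 1 else 0 := by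
  split_ifs with h
  · refine Finset.card_eq_one.2 ⟨runAt T i, Finset.ext fun p => ?_⟩
    rw [Finset.mem_filter, Finset.mem_singleton]
    constructor
    · exact fun hp => (runAt_eq hp.1 (Finset.mem_Icc.2 hp.2)).symm
    · rintro rfl
      exact ⟨runAt_mem h, Finset.mem_Icc.1 (mem_runAt h)⟩
  · rw [Finset.card_eq_zero, Finset.filter_eq_empty_iff]
    exact fun p hp hi => h (mem_of_mem_run hp (Finset.mem_Icc.2 hi))

/-- The weight of the position `i` in the interval `p`. -/
def runWeight (p : ℕ × ℕ) (i : ℕ) : ℤ := 2 * i - p.1 - p.2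

/-- For `j = a + s - 1` the term `λ + 1 - 2s` is the negative of the weight, and squaring removes
the sign. -/
theorem sum_sq_eq_sum_runWeight {a b : ℕ} (hab : a ≤ b) :
    ∑ s ∈ Finset.Icc 1 (b + 1 - a), (((b + 1 - a : ℕ) : ℝ) + 1 - 2 * (s : ℝ)) ^ 2
      = ∑ j ∈ Finset.Icc a b, (runWeight (a, b) j : ℝ) ^ 2 := by
  refine Finset.sum_bij' (fun s _ => a + s - 1) (fun j _ => j + 1 - a) ?_ ?_ ?_ ?_ ?_ <;>
    intro s hs <;> simp only [Finset.mem_Icc] at hs ⊢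
  · omega
  · omega
  · omega
  · omega
  · rw [runWeight]
    push_cast [show a ≤ b + 1 by omega, show 1 ≤ a + s by omega]
    ring

/-- The denominator of the constant of the conjugate partition, as a sum over all runs. -/
theorem partitionConst_conjugatePartition {n : ℕ} (R : Composition n) :
    partitionConst (conjugatePartition R) = 4 / ∑ l ∈ Finset.Icc 1 n, ∑ p ∈ runs (levelSet R l),
      ∑ j ∈ Finset.Icc p.1 p.2, (runWeight p j : ℝ) ^ 2 := by
  rw [partitionConst]
  congr 1
  change (Multiset.map _ (∑ i ∈ Finset.Icc 1 n, runLengths (levelSet R i))).sum = _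
  rw [← Multiset.coe_mapAddMonoidHom, map_sum, ← Multiset.coe_sumAddMonoidHom, map_sum]
  refine Finset.sum_congr rfl fun l _ => ?_
  rw [Multiset.coe_sumAddMonoidHom, Multiset.coe_mapAddMonoidHom, runLengths, Multiset.map_map]
  refine Finset.sum_congr rfl fun p hp => ?_
  exact sum_sq_eq_sum_runWeight (mem_runs.1 (show (p.1, p.2) ∈ runs (levelSet R l) from hp)).1

end Runs
-- Part (a): the lower bound.
section LowerBound

variable {n : ℕ} {R : Composition n} {A : Matrix (Fin n) (Fin n) ℂ}
  {V : Fin R.length → Submodule ℂ (EuclideanSpace ℂ (Fin n))}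

/-- The runs of all level sets of `R`. -/
def allRuns (R : Composition n) : Finset ((_ : ℕ) × (ℕ × ℕ)) :=
  (Finset.Icc 1 n).sigma fun l => runs (levelSet R l)

/-- Position `i` lies in exactly one run at each level `1, …, r_i`. Runs carry their level as a tag,
so equal intervals at different levels are counted separately. -/
theorem card_filter_allRuns (R : Composition n) (i : ℕ) :
    ((allRuns R).filter fun p => p.2.1 ≤ i ∧ i ≤ p.2.2).card
      = if h : i < R.length then R.blocksFun ⟨i, h⟩ else 0 := by
  rw [Finset.card_filter, allRuns, Finset.sum_sigma]
  simp only [← Finset.card_filter, card_filter_runs]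
  split_ifs with h
  · have h1 := blocksFun_le_self R ⟨i, h⟩
    have : (Finset.Icc 1 n).filter (fun l => i ∈ levelSet R l)
        = Finset.Icc 1 (R.blocksFun ⟨i, h⟩) := by
      ext l
      simp only [Finset.mem_filter, Finset.mem_Icc, mem_levelSet, h, exists_true_left]
      omega
    rw [this]
    simp
  · rw [Finset.card_eq_zero, Finset.filter_eq_empty_iff]
    exact fun l _ hi => h (mem_levelSet.1 hi).1

theorem card_allRuns_sigma (R : Composition n) :
    ((allRuns R).sigma fun p => Finset.Icc p.2.1 p.2.2).card = n := by
  rw [Finset.card_sigma, allRuns, Finset.sum_sigma]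
  conv_rhs => rw [← sum_card_levelSet R]
  refine Finset.sum_congr rfl fun l _ => ?_
  rw [← sum_runLengths]
  simp only [Nat.card_Icc]
  rfl

theorem IsOfType.exists_weighted_spanning (hV : IsOfType R A V) :
    ∃ f : (_ : ℕ) × (ℕ × ℕ) → ℕ → EuclideanSpace ℂ (Fin n),
      (∀ i, V i ≤ Submodule.span ℂ ((f · i) '' {p | p ∈ allRuns R ∧ p.2.1 ≤ i ∧ i ≤ p.2.2})) ∧
      ∀ p ∈ allRuns R, ∀ i, p.2.1 ≤ i → i ≤ p.2.2 → A.toEuclideanLin (f p i) ∈ Submodule.span ℂ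
        ((f · (i + 1)) '' {q | q ∈ allRuns R ∧ (q.2.1 ≤ i + 1 ∧ i + 1 ≤ q.2.2) ∧
          q.2.1 + q.2.2 ≤ p.2.1 + p.2.2}) := by
  obtain ⟨f, hf, hT⟩ := exists_filtered_spanning A.toEuclideanLin (fun p => p.2.1) (fun p => p.2.2)
    (allRuns R)
    (fun p hp => (mem_runs.1 (show (p.2.1, p.2.2) ∈ runs (levelSet R p.1) from
      (Finset.mem_sigma.1 hp).2)).1)
    (fun p hp q hq h1 h2 => by
      refine run_le_of_adjacent ?_ (Finset.mem_sigma.1 hp).2 (Finset.mem_sigma.1 hq).2 h1 h2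
      exact (le_total q.1 p.1).imp (levelSet_anti R) (levelSet_anti R))
    -- Padding by `⊥` makes this a representation on all of `ℕ`; `map_last` covers the step off the
    -- end.
    (fun i => if h : i < R.length then V ⟨i, h⟩ else ⊥)
    (fun i => by
      by_cases h : i < R.length
      · rw [dif_pos h]
        intro x hx
        by_cases h' : i + 1 < R.length
        · rw [dif_pos h']
          exact hV.map_mem ⟨i, h⟩ ⟨i + 1, h'⟩ rfl x hx
        · rw [dif_neg h', Submodule.mem_comap,
            hV.map_last ⟨i, h⟩ (show i + 1 = R.length by omega) x hx]
          exact Submodule.zero_mem _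
      · rw [dif_neg h]
        exact bot_le)
    (fun i => by
      rw [card_filter_allRuns]
      by_cases h : i < R.length
      · rw [dif_pos h, dif_pos h, hV.finrank_eq]
      · rw [dif_neg h, dif_neg h, finrank_bot])
  refine ⟨f, fun i => ?_, hT⟩
  rw [hf i, dif_pos i.2]

theorem IsOfType.partitionConst_le_momentK (hV : IsOfType R A V) (hA : A ≠ 0) :
    partitionConst (conjugatePartition R) ≤ momentK A := by
  obtain ⟨f, hf, hT⟩ := hV.exists_weighted_spanning
  let X := (allRuns R).sigma fun p => Finset.Icc p.2.1 p.2.2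
  have hX : ∀ p i, (⟨p, i⟩ : (_ : (_ : ℕ) × (ℕ × ℕ)) × ℕ) ∈ X ↔
      p ∈ allRuns R ∧ p.2.1 ≤ i ∧ i ≤ p.2.2 := fun p i => by
    simp only [X, Finset.mem_sigma, Finset.mem_Icc]
  obtain ⟨e, σ, he⟩ := exists_weighted_orthonormalBasis (X := X) A.toEuclideanLin
    (fun x => f x.1.1 x.1.2) (fun x => runWeight x.1.1.2 x.1.2)
    (by
      rw [← hV.isInternal.submodule_iSup_eq_top]
      refine iSup_le fun i => (hf i).trans (Submodule.span_mono ?_)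
      rintro _ ⟨p, hp, rfl⟩
      exact ⟨⟨⟨p, i⟩, (hX p i).2 hp⟩, rfl⟩)
    (by rw [Fintype.card_coe]; exact card_allRuns_sigma R)
    (finrank_euclideanSpace_fin)
    (by
      rintro ⟨⟨p, i⟩, hx⟩
      obtain ⟨hp, h1, h2⟩ := (hX p i).1 hx
      refine Submodule.span_mono ?_ (hT p hp i h1 h2)
      rintro _ ⟨q, ⟨hq, hq', hle⟩, rfl⟩
      refine ⟨⟨⟨q, i + 1⟩, (hX q (i + 1)).2 ⟨hq, hq'⟩⟩, ?_, rfl⟩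
      -- Moving from `i` to `i + 1` adds 2, and replacing `p` by `q` does not increase the
      -- subtracted sum of endpoints.
      simp only [runWeight, Set.mem_ofPred_eq]
      push_cast
      omega)
  refine le_trans (le_of_eq ?_) (le_momentK_of_weight hA e
    (fun x => (runWeight (σ x).1.1.2 (σ x).1.2 : ℝ)) fun x y hxy => by exact_mod_cast he x y hxy)
  rw [partitionConst_conjugatePartition,
    Equiv.sum_comp σ fun x => (runWeight x.1.1.2 x.1.2 : ℝ) ^ 2,
    Finset.sum_coe_sort X fun x => (runWeight x.1.2 x.2 : ℝ) ^ 2, Finset.sum_sigma, allRuns,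
    Finset.sum_sigma]

end LowerBound
-- Part (b): the equality case.
section Equality

variable {n : ℕ} {R : Composition n} {A : Matrix (Fin n) (Fin n) ℂ}
  {V : Fin R.length → Submodule ℂ (EuclideanSpace ℂ (Fin n))}
  {L : ∀ i : Fin R.length, Fin (R.blocksFun i) → Submodule ℂ (EuclideanSpace ℂ (Fin n))}
  {v : ∀ i : Fin R.length, Fin (R.blocksFun i) → EuclideanSpace ℂ (Fin n)}

theorem IsWeightedLineDecomposition.line_le (hL : IsWeightedLineDecomposition R A V L v)
    (i : Fin R.length) (s : Fin (R.blocksFun i)) : L i s ≤ V i :=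
  hL.iSup_eq i ▸ le_iSup (L i) s

theorem map_line_eq_zero (hV : IsOfType R A V) (hL : IsWeightedLineDecomposition R A V L v)
    (i : Fin R.length) (s : Fin (R.blocksFun i)) (h : (i : ℕ) + 1 ∉ levelSet R (s + 1))
    {x : EuclideanSpace ℂ (Fin n)} (hx : x ∈ L i s) : A.toEuclideanLin x = 0 := by
  by_cases hi : (i : ℕ) + 1 < R.length
  · refine hL.map_zero i ⟨i + 1, hi⟩ s rfl ?_ x hx
    by_contra hlt
    exact h (mem_levelSet.2 ⟨hi, by omega⟩)
  · exact hV.map_last i (by omega) x (hL.line_le i s hx)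

theorem nonzeroOnLine_iff (hV : IsOfType R A V) (hL : IsWeightedLineDecomposition R A V L v)
    (s j : ℕ) :
    NonzeroOnLine A L s j ↔ j ∈ levelSet R (s + 1) ∧ j + 1 ∈ levelSet R (s + 1) := by
  constructor
  · rintro ⟨hj, hs, x, hx, hne⟩
    exact ⟨mem_levelSet.2 ⟨hj, hs⟩, by_contra fun h => hne (map_line_eq_zero hV hL _ _ h hx)⟩
  · rintro ⟨h, h'⟩
    obtain ⟨hj, hs⟩ := mem_levelSet.1 h
    obtain ⟨hj', hs'⟩ := mem_levelSet.1 h'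
    refine ⟨hj, hs, ?_⟩
    by_contra! hall
    have h1 := hL.map_line ⟨j, hj⟩ ⟨j + 1, hj'⟩ ⟨s, hs⟩ ⟨s, hs'⟩ rfl rfl
    have h2 : v ⟨j + 1, hj'⟩ ⟨s, hs'⟩ = 0 := by
      have h3 := hL.unit_mem ⟨j + 1, hj'⟩ ⟨s, hs'⟩
      rw [← h1] at h3
      obtain ⟨x, hx, hxv⟩ := h3
      rw [← hxv, hall x hx]
    have h4 := hL.norm_unit ⟨j + 1, hj'⟩ ⟨s, hs'⟩
    simp [h2] at h4

/-- Identifies `[j₀, j₁]` with a run, so that `weight` applies with run endpoints. Lines are counted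
from `0` and levels from `1`, hence `s + 1`. -/
theorem isMaximalInterval_runAt (hV : IsOfType R A V)
    (hL : IsWeightedLineDecomposition R A V L v) {s i : ℕ} (hi : i ∈ levelSet R (s + 1)) :
    IsMaximalInterval A L s i (runAt (levelSet R (s + 1)) i).1
      (runAt (levelSet R (s + 1)) i).2 := by
  have hr := runAt_mem hi
  obtain ⟨h1, h2⟩ := Finset.mem_Icc.1 (mem_runAt hi)
  generalize runAt (levelSet R (s + 1)) i = p at hr h1 h2 ⊢
  obtain ⟨a, b⟩ := p
  obtain ⟨-, hT, ha, hb⟩ := mem_runs.1 hr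
  refine ⟨h1, h2, fun j hj hj' => ?_, fun j hj h => ?_, fun h => ?_⟩
  · exact (nonzeroOnLine_iff hV hL s j).2
      ⟨hT (Finset.mem_Icc.2 ⟨hj, hj'.le⟩), hT (Finset.mem_Icc.2 ⟨hj.trans (Nat.le_succ j), hj'⟩)⟩
  · exact ha j ((nonzeroOnLine_iff hV hL s j).1 h).1 hj
  · exact hb ((nonzeroOnLine_iff hV hL s b).1 h).2

theorem orthonormal_lines (hVo : ∀ i j, i ≠ j → V i ⟂ V j)
    (hL : IsWeightedLineDecomposition R A V L v) :
    Orthonormal ℂ fun x : (i : Fin R.length) × Fin (R.blocksFun i) => v x.1 x.2 := by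
  refine ⟨fun x => hL.norm_unit _ _, ?_⟩
  rintro ⟨i, s⟩ ⟨j, t⟩ hne
  by_cases hij : i = j
  · subst hij
    have hst : s ≠ t := fun h => hne (h ▸ rfl)
    exact Submodule.isOrtho_iff_inner_eq.1 (hL.ortho i s t hst) _ (hL.unit_mem i s) _
      (hL.unit_mem i t)
  · exact Submodule.isOrtho_iff_inner_eq.1 (hVo i j hij) _ (hL.line_le i s (hL.unit_mem i s)) _
      (hL.line_le j t (hL.unit_mem j t))

/-- The run of positions around the cell `x = (i, s)` of the composition at its level. -/
noncomputable def cellRun (x : (i : Fin R.length) × Fin (R.blocksFun i)) : ℕ × ℕ :=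
  runAt (levelSet R (x.2 + 1)) x.1

theorem cell_mem (x : (i : Fin R.length) × Fin (R.blocksFun i)) :
    (x.1 : ℕ) ∈ levelSet R (x.2 + 1) :=
  mem_levelSet.2 ⟨x.1.2, x.2.2⟩

theorem cellRun_le (x : (i : Fin R.length) × Fin (R.blocksFun i)) :
    (cellRun x).1 ≤ x.1 ∧ x.1 ≤ (cellRun x).2 :=
  Finset.mem_Icc.1 (mem_runAt (cell_mem x))

/-- The cell `y` follows `x` at the same level. -/
def IsNextCell (x y : (i : Fin R.length) × Fin (R.blocksFun i)) : Prop :=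
  (y.1 : ℕ) = x.1 + 1 ∧ (y.2 : ℕ) = x.2

theorem cell_ext {x y : (i : Fin R.length) × Fin (R.blocksFun i)} (h1 : (x.1 : ℕ) = y.1)
    (h2 : (x.2 : ℕ) = y.2) : x = y := by
  obtain ⟨i, s⟩ := x
  obtain ⟨j, t⟩ := y
  obtain rfl : i = j := Fin.ext h1
  obtain rfl : s = t := Fin.ext h2
  rfl

theorem IsNextCell.cellRun_eq {x y : (i : Fin R.length) × Fin (R.blocksFun i)}
    (h : IsNextCell x y) : cellRun y = cellRun x := by
  have hy := cell_mem y
  rw [h.1, h.2] at hy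
  rw [cellRun, cellRun, h.1, h.2, runAt_succ (cell_mem x) hy]

theorem exists_isNextCell (x : (i : Fin R.length) × Fin (R.blocksFun i))
    (h : (x.1 : ℕ) ≠ (cellRun x).2) : ∃ y, IsNextCell x y := by
  have h1 := cellRun_le x
  obtain ⟨hi, hs⟩ := mem_levelSet.1 (mem_of_mem_run (runAt_mem (cell_mem x))
    (Finset.mem_Icc.2 ⟨h1.1.trans (Nat.le_succ _), lt_of_le_of_ne h1.2 h⟩))
  exact ⟨⟨⟨_, hi⟩, ⟨x.2, hs⟩⟩, rfl, rfl⟩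

theorem exists_isNextCell_left (x : (i : Fin R.length) × Fin (R.blocksFun i))
    (h : (x.1 : ℕ) ≠ (cellRun x).1) : ∃ y, IsNextCell y x := by
  have h1 := cellRun_le x
  obtain ⟨hi, hs⟩ := mem_levelSet.1 (mem_of_mem_run (runAt_mem (cell_mem x)) (j := x.1 - 1)
    (Finset.mem_Icc.2 ⟨show (cellRun x).1 ≤ _ by omega, (Nat.sub_le _ _).trans h1.2⟩))
  exact ⟨⟨⟨_, hi⟩, ⟨x.2, hs⟩⟩, show (x.1 : ℕ) = x.1 - 1 + 1 by omega, rfl⟩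

theorem norm_inner_line_sq (hV : IsOfType R A V) (hVo : ∀ i j, i ≠ j → V i ⟂ V j)
    (hL : IsWeightedLineDecomposition R A V L v)
    (x y : (i : Fin R.length) × Fin (R.blocksFun i)) [Decidable (IsNextCell x y)] :
    ‖inner ℂ (v y.1 y.2) (A.toEuclideanLin (v x.1 x.2))‖ ^ 2 = if IsNextCell x y then
      ((x.1 : ℝ) - (cellRun x).1 + 1) * ((cellRun x).2 - (x.1 : ℝ)) else 0 := by
  have hon := orthonormal_lines hVo hL
  obtain ⟨h1, h2⟩ := cellRun_le x
  have h1' : ((cellRun x).1 : ℝ) ≤ (x.1 : ℕ) := by exact_mod_cast h1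
  have h2' : ((x.1 : ℕ) : ℝ) ≤ (cellRun x).2 := by exact_mod_cast h2
  have hw : ∀ z, IsNextCell x z → A.toEuclideanLin (v x.1 x.2)
      = ((√(((x.1 : ℝ) - (cellRun x).1 + 1) * ((cellRun x).2 - (x.1 : ℝ))) : ℝ) : ℂ)
        • v z.1 z.2 :=
    fun z hz => hL.weight x.1 z.1 x.2 z.2 hz.1 hz.2 _ _
      (isMaximalInterval_runAt hV hL (cell_mem x))
  split_ifs with h
  · rw [hw y h, inner_smul_right, inner_self_eq_norm_sq_to_K, hL.norm_unit]
    simp only [Complex.coe_algebraMap, Complex.ofReal_one, one_pow, mul_one, Complex.norm_real,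
      Real.norm_eq_abs, sq_abs]
    exact Real.sq_sqrt (mul_nonneg (by linarith) (by linarith))
  · by_cases hx : (x.1 : ℕ) = (cellRun x).2
    · rw [map_line_eq_zero hV hL x.1 x.2 ?_ (hL.unit_mem x.1 x.2), inner_zero_right]
      · simp
      · rw [hx]
        exact (mem_runs.1 (show ((cellRun x).1, (cellRun x).2) ∈ runs (levelSet R (x.2 + 1)) from
          runAt_mem (cell_mem x))).2.2.2
    · obtain ⟨z, hz⟩ := exists_isNextCell x hx
      have hyz : y ≠ z := fun hyz => h (hyz ▸ hz)
      rw [hw z hz, inner_smul_right, hon.2 hyz]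
      simp

/-- All parts are positive, so the first lines of `V_1` and `V_2` exist and `A` maps one onto the
other. -/
theorem IsWeightedLineDecomposition.ne_zero (hR : 2 ≤ R.length)
    (hL : IsWeightedLineDecomposition R A V L v) : A ≠ 0 := by
  rintro rfl
  have h0 : 0 < R.blocksFun ⟨0, by omega⟩ := R.blocks_pos (R.blocksFun_mem_blocks _)
  have h1 : 0 < R.blocksFun ⟨1, by omega⟩ := R.blocks_pos (R.blocksFun_mem_blocks _)
  have h2 := hL.map_line ⟨0, by omega⟩ ⟨1, by omega⟩ ⟨0, h0⟩ ⟨0, h1⟩ rfl rfl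
  have h3 := hL.unit_mem ⟨1, by omega⟩ ⟨0, h1⟩
  rw [← h2, _root_.map_zero, Submodule.map_zero, Submodule.mem_bot] at h3
  have h4 := hL.norm_unit ⟨1, by omega⟩ ⟨0, h1⟩
  simp [h3] at h4

theorem IsWeightedLineDecomposition.momentK_eq (hR : 2 ≤ R.length) (hV : IsOfType R A V)
    (hVo : ∀ i j, i ≠ j → V i ⟂ V j) (hL : IsWeightedLineDecomposition R A V L v) :
    momentK A = partitionConst (conjugatePartition R) := by
  classical
  have hon := orthonormal_lines hVo hL
  have hcard : Fintype.card ((i : Fin R.length) × Fin (R.blocksFun i)) = n := by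
    simp [R.sum_blocksFun]
  have hfin : Module.finrank ℂ (EuclideanSpace ℂ (Fin n))
      = Fintype.card ((i : Fin R.length) × Fin (R.blocksFun i)) := by
    rw [hcard, finrank_euclideanSpace_fin]
  let σ := Fintype.equivFinOfCardEq hcard
  let e := (OrthonormalBasis.mk hon
    (hon.linearIndependent.span_eq_top_of_card_eq_finrank' hfin.symm).ge).reindex σ
  have he : ∀ k, e k = v (σ.symm k).1 (σ.symm k).2 := fun k => by simp [e]
  have hsq := norm_inner_line_sq hV hVo hL
  have hnext : ∀ x y, inner ℂ (e y) (A.toEuclideanLin (e x)) ≠ 0 →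
      IsNextCell (σ.symm x) (σ.symm y) := fun x y hxy => by
    by_contra h
    have h1 := hsq (σ.symm x) (σ.symm y)
    rw [if_neg h, ← he, ← he] at h1
    exact hxy (norm_eq_zero.1 (pow_eq_zero_iff two_ne_zero |>.1 h1))
  rw [momentK_eq_of_weight (hL.ne_zero hR) e
    (fun k => (runWeight (cellRun (σ.symm k)) (σ.symm k).1 : ℝ)) ?_ ?_ ?_ ?_,
    partitionConst_conjugatePartition]
  · congr 1
    rw [Equiv.sum_comp σ.symm fun x => (runWeight (cellRun x) x.1 : ℝ) ^ 2]
    simp only [sum_runs _ fun p j => (runWeight p j : ℝ) ^ 2]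
    rw [sum_levelSet R fun l j => (runWeight (runAt (levelSet R l) j) j : ℝ) ^ 2]
    rfl
  · intro x y hxy
    have h := hnext x y hxy
    rw [h.cellRun_eq, h.1, runWeight, runWeight]
    push_cast
    ring
  · intro x y z hx hy
    have h1 := hnext z x hx
    have h2 := hnext z y hy
    exact σ.symm.injective (cell_ext (by rw [h1.1, h2.1]) (by rw [h1.2, h2.2]))
  · intro x y z hx hy
    have h1 := hnext x z hx
    have h2 := hnext y z hy
    exact σ.symm.injective (cell_ext (by have := h1.1; have := h2.1; omega)
      (by rw [← h1.2, ← h2.2]))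
  · intro k
    simp only [he, hsq]
    rw [Equiv.sum_comp σ.symm fun y => if IsNextCell y (σ.symm k) then
        ((y.1 : ℝ) - (cellRun y).1 + 1) * ((cellRun y).2 - (y.1 : ℝ)) else 0,
      Equiv.sum_comp σ.symm fun y => if IsNextCell (σ.symm k) y then
        (((σ.symm k).1 : ℝ) - (cellRun (σ.symm k)).1 + 1)
          * ((cellRun (σ.symm k)).2 - ((σ.symm k).1 : ℝ)) else 0]
    generalize σ.symm k = x
    -- With `p = i - a` and `q = b - i`, the incoming square is `p(q + 1)` and the outgoing one `(p
    -- + 1)q`. Their difference `p - q` is the weight. Both formulas give `0` at the end where the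
    -- neighbour is missing.
    have hin : (∑ y, if IsNextCell y x then
        ((y.1 : ℝ) - (cellRun y).1 + 1) * ((cellRun y).2 - (y.1 : ℝ)) else 0)
        = ((x.1 : ℝ) - (cellRun x).1) * ((cellRun x).2 - (x.1 : ℝ) + 1) := by
      by_cases hx : (x.1 : ℕ) = (cellRun x).1
      · rw [hx, sub_self, zero_mul]
        refine Finset.sum_eq_zero fun y _ => if_neg fun h => ?_
        have h1 := (cellRun_le y).1
        rw [← h.cellRun_eq, ← hx, h.1] at h1
        omega
      · obtain ⟨y, hy⟩ := exists_isNextCell_left x hx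
        rw [Finset.sum_eq_single y, if_pos hy, hy.cellRun_eq, hy.1]
        · push_cast
          ring
        · intro z _ hzy
          refine if_neg fun hz => hzy (cell_ext ?_ ?_)
          · have := hy.1
            have := hz.1
            omega
          · rw [← hy.2, ← hz.2]
        · simp
    have hout : (∑ y, if IsNextCell x y then
        ((x.1 : ℝ) - (cellRun x).1 + 1) * ((cellRun x).2 - (x.1 : ℝ)) else 0)
        = ((x.1 : ℝ) - (cellRun x).1 + 1) * ((cellRun x).2 - (x.1 : ℝ)) := by
      by_cases hx : (x.1 : ℕ) = (cellRun x).2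
      · simp [hx]
      · obtain ⟨y, hy⟩ := exists_isNextCell x hx
        rw [Finset.sum_eq_single y, if_pos hy]
        · intro z _ hzy
          exact if_neg fun hz => hzy (cell_ext (by rw [hy.1, hz.1]) (by rw [hy.2, hz.2]))
        · simp
    rw [hin, hout, runWeight]
    push_cast
    ring

end Equality

theorem mainTheorem5 {n : ℕ} (R : Composition n) (A : Matrix (Fin n) (Fin n) ℂ)
    (V : Fin R.length → Submodule ℂ (EuclideanSpace ℂ (Fin n))) (hV : IsOfType R A V) :
    (A ≠ 0 → partitionConst (conjugatePartition R) ≤ momentK A) ∧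
    (2 ≤ R.length → (∀ i j, i ≠ j → V i ⟂ V j) →
      ∀ (L : ∀ i : Fin R.length, Fin (R.blocksFun i) →
          Submodule ℂ (EuclideanSpace ℂ (Fin n)))
        (v : ∀ i : Fin R.length, Fin (R.blocksFun i) → EuclideanSpace ℂ (Fin n)),
        IsWeightedLineDecomposition R A V L v →
        A ≠ 0 ∧ momentK A = partitionConst (conjugatePartition R)) := by
  exact ⟨hV.partitionConst_le_momentK, fun hR hVo _ _ hL =>
    ⟨hL.ne_zero hR, hL.momentK_eq hR hV hVo⟩⟩
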